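/- Formulas are built from a denumerable set of propositional variables and $\bot$ with $\land,\lor,\supset$. A Kripke model $\mathcal K=\langle P,\le,\rho,V\rangle$ is a finite poset with minimum $\rho$ and a monotone valuation $V$ of the variables, with the usual intuitionistic forcing $\Vdash$; it is a countermodel for $G$ if $\rho\nVdash G$. $\mathrm{IPL}$ is the set of formulas that have no countermodel. The height of a world is the maximal $n$ for which there is a chain of worlds $\alpha=\alpha_0<\dots<\alpha_n$ starting at it, the height $h(\mathcal K)$ of $\mathcal K$ is the height of $\rho$, and for $G\notin\mathrm{IPL}$, $h(G)$ is the minimum of $h(\mathcal K)$ over all countermodels $\mathcal K$ for $G$. Let $\mathrm{Sl}(G)$ and $\mathrm{Sr}(G)$ be the sets of left (negative) and right (positive) subformulas of $G$ (with $G\in\mathrm{Sr}(G)$), let $\overline\Gamma^{\mathrm{At}}$ and $\overline\Gamma^{\supset}$ be the sets of variables and of implications in $\mathrm{Sl}(G)$, and $\overline\Gamma=\overline\Gamma^{\mathrm{At}}\cup\overline\Gamma^{\supset}$. Let $\mathrm{Cl}(\Gamma)$ be the least set containing $\Gamma$ such that $X,Y\in\mathrm{Cl}(\Gamma)$ imply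 $X\land Y$, $A\lor X$, $X\lor A$, $A\supset X\in\mathrm{Cl}(\Gamma)$ for every formula $A$. The calculus $\mathrm{FRJ}(G)$ has regular sequents $\Gamma\Rightarrow C$ and irregular sequents $\Sigma;\Theta\to C$, whose left formulas are those in $\Gamma$, respectively $\Sigma\cup\Theta$. Its rules are the following, where the right formula of each conclusion must lie in $\mathrm{Sr}(G)$: (Axioms) $\overline\Gamma^{\mathrm{At}}\setminus\{F\}\Rightarrow F$ and $\emptyset;(\overline\Gamma^{\mathrm{At}}\setminus\{F\})\cup\overline\Gamma^{\supset}\to F$, for $F$ a variable or $\bot$. ($\land$) From $\Gamma\Rightarrow A_k$ infer $\Gamma\Rightarrow A_1\land A_2$; from $\Sigma;\Theta\to A_k$ infer $\Sigma;\Theta\to A_1\land A_2$ ($k\in\{1,2\}$). ($\lor$) From $\Sigma_1;\Theta_1\to C_1$ and $\Sigma_2;\Theta_2\to C_2$ infer $\Sigma_1\cup\Sigma_2;\Theta_1\cap\Theta_2\to C_1\lor C_2$, if $\Sigma_1\subseteq\Sigma_2\cup\Theta_2$ and $\Sigma_2\subseteq\Sigma_1\cup\Theta_1$. ($\supset_\in$)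 From $\Gamma\Rightarrow B$ infer $\Gamma\Rightarrow A\supset B$, if $A\in\mathrm{Cl}(\Gamma)$; from $\Sigma;\Theta\cup\Lambda\to B$ infer $\Sigma\cup\Lambda;\Theta\to A\supset B$, if $\Theta\cap\Lambda=\emptyset$, $A\in\mathrm{Cl}(\Sigma\cup\Lambda)$, and $A\notin\mathrm{Cl}(\Sigma\cup\Lambda')$ for all $\Lambda'\subsetneq\Lambda$. ($\supset_{\notin}$) From $\Gamma\Rightarrow B$ infer $\emptyset;\Theta\to A\supset B$, if $\Theta\subseteq\mathrm{Cl}(\Gamma)\cap\overline\Gamma$, $A\in\mathrm{Cl}(\Gamma)\setminus\mathrm{Cl}(\Theta)$, and $A\in\mathrm{Cl}(\Theta')$ whenever $\Theta\subsetneq\Theta'\subseteq\mathrm{Cl}(\Gamma)\cap\overline\Gamma$. (Joins) Given $n\ge1$ premises $\Sigma_j;\Theta_j\to A_j$ with $\Sigma_i\subseteq\Sigma_j\cup\Theta_j$ for $i\ne j$, let $\Upsilon=\{A_1,\dots,A_n\}$; let $\Sigma^{\mathrm{At}},\Sigma^{\supset}$ be the sets of variables and implications in $\bigcup_j\Sigma_j$,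 let $\Theta^{\mathrm{At}}$ be the set of variables in $\bigcap_j\Theta_j$, and let $\Theta^{\supset}$ be the set of implications $Y\supset Z\in\bigcap_j\Theta_j$ with $Y\in\Upsilon$. Assume that $Y\supset Z\in\Sigma^{\supset}$ implies $Y\in\Upsilon$. Rule $\Join^{\mathrm{At}}$ infers $\Sigma^{\mathrm{At}}\cup(\Theta^{\mathrm{At}}\setminus\{F\})\cup\Sigma^{\supset}\cup\Theta^{\supset}\Rightarrow F$, for $F$ a variable or $\bot$ with $F\notin\Sigma^{\mathrm{At}}$, if for every $Y\in\Upsilon$ there is $Z$ with $Y\supset Z\in\mathrm{Sl}(G)$. Rule $\Join^{\lor}$ infers $\Sigma^{\mathrm{At}}\cup\Theta^{\mathrm{At}}\cup\Sigma^{\supset}\cup\Theta^{\supset}\Rightarrow C_1\lor C_2$, for $C_1,C_2\in\Upsilon$, if for every $Y\in\Upsilon$ there is $Z$ with $Y\supset Z\in\mathrm{Sl}(G)$ or $Y\lor Z\in\mathrm{Sr}(G)$ or $Z\lor Y\in\mathrm{Sr}(G)$. An $\mathrm{FRJ}(G)$-derivation of $G$ is a finite derivation tree $\mathcal D$ with root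 sequent $\Gamma\Rightarrow G$ for some $\Gamma$. The worlds of the structure $\mathrm{Mod}(\mathcal D)$ are the regular sequents occurring in $\mathcal D$ as an axiom or as the conclusion of a join rule; $\sigma_1\le\sigma_2$ holds iff $\sigma_1=\sigma_2$ or $\sigma_1$ is reached from $\sigma_2$ by finitely many steps, each going from a premise to the conclusion of a rule application occurring in $\mathcal D$; the root is the minimum; and $V(\sigma)$ is the set of variables among the left formulas of $\sigma$. (This is a Kripke model.) **Theorem.** Let $G\notin\mathrm{IPL}$. Then there is an $\mathrm{FRJ}(G)$-derivation $\mathcal D$ of $G$ such that $\mathrm{Mod}(\mathcal D)$ is a countermodel for $G$ and $h(\mathrm{Mod}(\mathcal D))=h(G)$. -/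

import Mathlib

/-! Intuitionistic propositional formulas, finite Kripke models, the forward refutation calculus
`FRJ(G)` and the model extracted from a derivation. -/

namespace FRJ

/-- Formulas over the propositional variables `0, 1, 2, …`; `¬ A` is `A ⊃ ⊥`. -/
inductive Formula : Type
  | var : ℕ → Formula
  | bot : Formula
  | and : Formula → Formula → Formula
  | or : Formula → Formula → Formula
  | imp : Formula → Formula → Formula

/-- A Kripke model: a finite poset with a minimum `root` and a monotone valuation. -/
structure KripkeModel : Type 1 where
  World : Type
  [order : PartialOrder World]
  [finite : Finite World]
  root : World
  root_le : ∀ a : World, root ≤ a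
  val : World → Set ℕ
  val_mono : ∀ {a b : World}, a ≤ b → val a ⊆ val b

attribute [instance] KripkeModel.order KripkeModel.finite

namespace KripkeModel

/-- The forcing relation `K, a ⊩ A`. -/
def Forces (K : KripkeModel) : K.World → Formula → Prop
  | a, .var p => p ∈ K.val a
  | _, .bot => False
  | a, .and A B => K.Forces a A ∧ K.Forces a B
  | a, .or A B => K.Forces a A ∨ K.Forces a B
  | a, .imp A B => ∀ b : K.World, a ≤ b → ¬ K.Forces b A ∨ K.Forces b B

/-- `K` is a countermodel for `A`. -/
def IsCountermodel (K : KripkeModel) (A : Formula) : Prop := ¬ K.Forces K.root A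

/-- The height of a world: the maximal length `n` of a chain `a = a₀ < a₁ < ⋯ < aₙ`; that is, `0`
for a final (maximal) world, and otherwise `1` plus the maximum of the heights of the worlds above
it. -/
noncomputable def worldHeight (K : KripkeModel) (a : K.World) : ℕ∞ := Order.coheight a

/-- The height of a model is the height of its root. -/
noncomputable def height (K : KripkeModel) : ℕ∞ := K.worldHeight K.root

end KripkeModel

/-- Intuitionistic propositional logic: the formulas valid in all Kripke models. -/
def IPL : Set Formula := {A | ∀ K : KripkeModel, K.Forces K.root A}

/-- `h(G)`: the minimum height of a countermodel for `G` (it is `⊤` if there is none). -/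
noncomputable def Formula.height (G : Formula) : ℕ∞ :=
  ⨅ (K : KripkeModel) (_ : K.IsCountermodel G), K.height

/-! ### Left and right subformulas, closure -/

inductive Side : Type
  | left : Side
  | right : Side

def Side.flip : Side → Side
  | .left => .right
  | .right => .left

/-- Signed subformulas of `G`. -/
inductive SignedSub (G : Formula) : Side → Formula → Prop
  | self : SignedSub G .right G
  | and_left {s A B} : SignedSub G s (.and A B) → SignedSub G s A
  | and_right {s A B} : SignedSub G s (.and A B) → SignedSub G s B
  | or_left {s A B} : SignedSub G s (.or A B) → SignedSub G s A
  | or_right {s A B} : SignedSub G s (.or A B) → SignedSub G s B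
  | imp_left {s A B} : SignedSub G s (.imp A B) → SignedSub G s.flip A
  | imp_right {s A B} : SignedSub G s (.imp A B) → SignedSub G s B

/-- Left (negative) subformulas of `G`. -/
def Sl (G : Formula) : Set Formula := {A | SignedSub G .left A}

/-- Right (positive) subformulas of `G`. -/
def Sr (G : Formula) : Set Formula := {A | SignedSub G .right A}

/-- The propositional variables, as formulas. -/
def atoms : Set Formula := {A | ∃ p, A = .var p}

/-- The prime formulas: propositional variables and `⊥`. -/
def primes : Set Formula := atoms ∪ {.bot}

/-- The formulas with top-level connective `⊃`. -/
def imps : Set Formula := {A | ∃ B C, A = .imp B C}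

/-- Left variables of `G`. -/
def barAt (G : Formula) : Set Formula := Sl G ∩ atoms

/-- Left implications of `G`. -/
def barImp (G : Formula) : Set Formula := Sl G ∩ imps

/-- The formulas allowed on the left of a sequent. -/
def bar (G : Formula) : Set Formula := barAt G ∪ barImp G

/-- The closure `Cl(Γ)`. -/
inductive Cl (Γ : Set Formula) : Formula → Prop
  | base {C} : C ∈ Γ → Cl Γ C
  | and {X Y} : Cl Γ X → Cl Γ Y → Cl Γ (.and X Y)
  | or_right {A X} : Cl Γ X → Cl Γ (.or A X)
  | or_left {A X} : Cl Γ X → Cl Γ (.or X A)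
  | imp {A X} : Cl Γ X → Cl Γ (.imp A X)

/-! ### Sequents, rules, derivations -/

/-- `reg Γ C` is the regular sequent `Γ ⇒ C`; `irr S T C` is the irregular sequent `S ; T → C`. -/
inductive Sequent : Type
  | reg : Set Formula → Formula → Sequent
  | irr : Set Formula → Set Formula → Formula → Sequent

namespace Sequent

def lhs : Sequent → Set Formula
  | reg Γ _ => Γ
  | irr S T _ => S ∪ T

def rhs : Sequent → Formula
  | reg _ C => C
  | irr _ _ C => C

def IsRegular : Sequent → Prop
  | reg _ _ => True
  | irr _ _ _ => False

end Sequent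

inductive Rule : Type
  | axReg
  | axIrr
  | and
  | or
  | impIn
  | impNotIn
  | joinAt
  | joinOr

/-- `Rule.IsPrime r`: the rule is an axiom rule or a join rule. -/
def Rule.IsPrime : Rule → Prop
  | axReg => True
  | axIrr => True
  | joinAt => True
  | joinOr => True
  | _ => False

/-- The restriction of a set of implications to those with antecedent in `U`. -/
def restr (Γ U : Set Formula) : Set Formula := {A | A ∈ Γ ∧ ∃ Y Z, A = .imp Y Z ∧ Y ∈ U}

section Join

variable {n : ℕ} (S T : Fin n → Set Formula) (A : Fin n → Formula)

def sigmaAt : Set Formula := ⋃ j, S j ∩ atoms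

def sigmaImp : Set Formula := ⋃ j, S j ∩ imps

def thetaAt : Set Formula := {X | ∀ j, X ∈ T j ∩ atoms}

def thetaImp : Set Formula := restr {X | ∀ j, X ∈ T j ∩ imps} (Set.range A)

/-- The side conditions shared by the two join rules. -/
def JoinCond : Prop :=
  (∀ i j, i ≠ j → S i ⊆ S j ∪ T j) ∧
  (∀ Y Z, Formula.imp Y Z ∈ sigmaImp S → Y ∈ Set.range A)

end Join

/-- `Inst G r prems σ`: the sequent `σ` follows from the premises `prems` by an application of the
rule `r` of `FRJ(G)`. The minimality condition in `impIn` on irregular sequents, the maximality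
condition in `impNotIn`, and the conditions on the right formulas of the premises of the join rules
are the standing restrictions on derivations of the calculus. -/
inductive Inst (G : Formula) : Rule → {n : ℕ} → (Fin n → Sequent) → Sequent → Prop
  | axReg {F} : F ∈ primes → F ∈ Sr G →
      Inst G .axReg ![] (.reg (barAt G \ {F}) F)
  | axIrr {F} : F ∈ primes → F ∈ Sr G →
      Inst G .axIrr ![] (.irr ∅ ((barAt G \ {F}) ∪ barImp G) F)
  | andReg₁ {Γ A₁ A₂} : .and A₁ A₂ ∈ Sr G →
      Inst G .and ![.reg Γ A₁] (.reg Γ (.and A₁ A₂))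
  | andReg₂ {Γ A₁ A₂} : .and A₁ A₂ ∈ Sr G →
      Inst G .and ![.reg Γ A₂] (.reg Γ (.and A₁ A₂))
  | andIrr₁ {S T A₁ A₂} : .and A₁ A₂ ∈ Sr G →
      Inst G .and ![.irr S T A₁] (.irr S T (.and A₁ A₂))
  | andIrr₂ {S T A₁ A₂} : .and A₁ A₂ ∈ Sr G →
      Inst G .and ![.irr S T A₂] (.irr S T (.and A₁ A₂))
  | or {S₁ T₁ S₂ T₂ C₁ C₂} : .or C₁ C₂ ∈ Sr G →
      S₁ ⊆ S₂ ∪ T₂ → S₂ ⊆ S₁ ∪ T₁ →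
      Inst G .or ![.irr S₁ T₁ C₁, .irr S₂ T₂ C₂] (.irr (S₁ ∪ S₂) (T₁ ∩ T₂) (.or C₁ C₂))
  | impInReg {Γ A B} : .imp A B ∈ Sr G → Cl Γ A →
      Inst G .impIn ![.reg Γ B] (.reg Γ (.imp A B))
  | impInIrr {S T L A B} : .imp A B ∈ Sr G →
      T ∩ L = ∅ → Cl (S ∪ L) A → (∀ L', L' ⊂ L → ¬ Cl (S ∪ L') A) →
      Inst G .impIn ![.irr S (T ∪ L) B] (.irr (S ∪ L) T (.imp A B))
  | impNotIn {Γ T A B} : .imp A B ∈ Sr G →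
      T ⊆ {X | Cl Γ X} ∩ bar G → Cl Γ A → ¬ Cl T A →
      (∀ T', T ⊂ T' → T' ⊆ {X | Cl Γ X} ∩ bar G → Cl T' A) →
      Inst G .impNotIn ![.reg Γ B] (.irr ∅ T (.imp A B))
  | joinAt {n : ℕ} {S T : Fin n → Set Formula} {A : Fin n → Formula} {F} : 1 ≤ n →
      F ∈ Sr G → JoinCond S T A → F ∈ primes → F ∉ sigmaAt S →
      (∀ Y ∈ Set.range A, ∃ Z, .imp Y Z ∈ Sl G) →
      Inst G .joinAt (fun j => .irr (S j) (T j) (A j))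
        (.reg (sigmaAt S ∪ (thetaAt T \ {F}) ∪ sigmaImp S ∪ thetaImp T A) F)
  | joinOr {n : ℕ} {S T : Fin n → Set Formula} {A : Fin n → Formula} {C₁ C₂} : 1 ≤ n →
      .or C₁ C₂ ∈ Sr G → JoinCond S T A → C₁ ∈ Set.range A → C₂ ∈ Set.range A →
      (∀ Y ∈ Set.range A, ∃ Z, .imp Y Z ∈ Sl G ∨ .or Y Z ∈ Sr G ∨ .or Z Y ∈ Sr G) →
      Inst G .joinOr (fun j => .irr (S j) (T j) (A j))
        (.reg (sigmaAt S ∪ thetaAt T ∪ sigmaImp S ∪ thetaImp T A) (.or C₁ C₂))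

/-- `FRJ(G)`-derivations (finite trees) with a given root sequent. -/
inductive Derivation (G : Formula) : Sequent → Type
  | node {n : ℕ} (r : Rule) (prems : Fin n → Sequent) (σ : Sequent) (h : Inst G r prems σ)
      (sub : ∀ i, Derivation G (prems i)) : Derivation G σ

namespace Derivation

variable {G : Formula}

/-- `D.Step σ₁ σ₂`: some rule application occurring in `D` has `σ₁` as a premise and `σ₂` as its
conclusion. -/
def Step : {σ : Sequent} → Derivation G σ → Sequent → Sequent → Prop
  | _, node _ prems σ _ sub => fun τ₁ τ₂ =>
      (τ₂ = σ ∧ ∃ i, τ₁ = prems i) ∨ ∃ i, (sub i).Step τ₁ τ₂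

/-- The p-sequents of `D`: the regular sequents occurring in `D` as an axiom or as the conclusion
of a join rule. -/
def PSeq : {σ : Sequent} → Derivation G σ → Set Sequent
  | _, node r _ σ _ sub =>
      {τ | (τ = σ ∧ σ.IsRegular ∧ r.IsPrime) ∨ ∃ i, τ ∈ (sub i).PSeq}

end Derivation

/-! ### Facts needed to see that the extracted structure is a Kripke model -/

theorem Cl.trans {Γ Δ : Set Formula} (h : ∀ A ∈ Γ, Cl Δ A) {A : Formula} (hA : Cl Γ A) :
    Cl Δ A := by
  induction hA with
  | base hC => exact h _ hC
  | and _ _ h₁ h₂ => exact .and h₁ h₂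
  | or_right _ h => exact .or_right h
  | or_left _ h => exact .or_left h
  | imp _ h => exact .imp h

theorem Cl.var_mem {Γ : Set Formula} {p : ℕ} (h : Cl Γ (.var p)) : Formula.var p ∈ Γ := by
  cases h; assumption

theorem Inst.lhs_le {G : Formula} {r : Rule} {n : ℕ} {prems : Fin n → Sequent} {σ : Sequent}
    (h : Inst G r prems σ) (i : Fin n) : ∀ A ∈ σ.lhs, Cl (prems i).lhs A := by
  have join : ∀ {m : ℕ} {S T : Fin m → Set Formula} {A : Fin m → Formula} (i : Fin m),
      JoinCond S T A → ∀ X, X ∈ sigmaAt S ∪ thetaAt T ∪ sigmaImp S ∪ thetaImp T A →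
      Cl (S i ∪ T i) X := by
    intro m S T A i hJ X hX
    have hS : ∀ j, X ∈ S j → X ∈ S i ∪ T i := fun j hj => by
      by_cases hji : j = i
      · subst hji; exact Or.inl hj
      · exact hJ.1 j i hji hj
    refine .base ?_
    rcases hX with ((hX | hX) | hX) | hX
    · obtain ⟨j, hj⟩ := Set.mem_iUnion.1 hX
      exact hS j hj.1
    · exact Or.inr (hX i).1
    · obtain ⟨j, hj⟩ := Set.mem_iUnion.1 hX
      exact hS j hj.1
    · exact Or.inr (hX.1 i).1
  cases h with
  | axReg => exact i.elim0
  | axIrr => exact i.elim0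
  | andReg₁ => fin_cases i; exact fun A hA => .base hA
  | andReg₂ => fin_cases i; exact fun A hA => .base hA
  | andIrr₁ => fin_cases i; exact fun A hA => .base hA
  | andIrr₂ => fin_cases i; exact fun A hA => .base hA
  | or _ h₁ h₂ =>
    fin_cases i
    · rintro A ((hA | hA) | hA)
      · exact .base (Or.inl hA)
      · exact .base (h₂ hA)
      · exact .base (Or.inr hA.1)
    · rintro A ((hA | hA) | hA)
      · exact .base (h₁ hA)
      · exact .base (Or.inl hA)
      · exact .base (Or.inr hA.2)
  | impInReg => fin_cases i; exact fun A hA => .base hA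
  | impInIrr =>
    fin_cases i
    rintro A ((hA | hA) | hA)
    · exact .base (Or.inl hA)
    · exact .base (Or.inr (Or.inr hA))
    · exact .base (Or.inr (Or.inl hA))
  | impNotIn _ hT =>
    fin_cases i
    rintro A (hA | hA)
    · exact hA.elim
    · exact (hT hA).1
  | joinAt _ _ hJ =>
    intro X hX
    refine join i hJ X ?_
    rcases hX with ((hX | hX) | hX) | hX
    · exact Or.inl (Or.inl (Or.inl hX))
    · exact Or.inl (Or.inl (Or.inr hX.1))
    · exact Or.inl (Or.inr hX)
    · exact Or.inr hX
  | joinOr _ _ hJ => exact fun X hX => join i hJ X hX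

theorem Inst.of_regular {G : Formula} {r : Rule} {n : ℕ} {prems : Fin n → Sequent} {σ : Sequent}
    (h : Inst G r prems σ) (i : Fin n) (hi : (prems i).IsRegular) :
    (∃ A, Cl (prems i).lhs A ∧ ¬ Cl σ.lhs A) ∨
      (σ.IsRegular ∧ sizeOf (prems i).rhs < sizeOf σ.rhs) := by
  cases h with
  | axReg => exact i.elim0
  | axIrr => exact i.elim0
  | andReg₁ => fin_cases i; exact Or.inr ⟨trivial, by simp [Sequent.rhs]; omega⟩
  | andReg₂ => fin_cases i; exact Or.inr ⟨trivial, by simp [Sequent.rhs]⟩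
  | andIrr₁ => fin_cases i; exact hi.elim
  | andIrr₂ => fin_cases i; exact hi.elim
  | or => fin_cases i <;> exact hi.elim
  | impInReg => fin_cases i; exact Or.inr ⟨trivial, by simp [Sequent.rhs]⟩
  | impInIrr => fin_cases i; exact hi.elim
  | @impNotIn Γ T A B _ _ h₁ h₂ =>
    fin_cases i
    exact Or.inl ⟨A, h₁, by simpa [Sequent.lhs] using h₂⟩
  | joinAt => exact hi.elim
  | joinOr => exact hi.elim

namespace Derivation

open Relation

variable {G : Formula}

theorem exists_inst_of_step {σ : Sequent} (D : Derivation G σ) {τ₁ τ₂ : Sequent}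
    (h : D.Step τ₁ τ₂) :
    ∃ (r : Rule) (n : ℕ) (prems : Fin n → Sequent) (i : Fin n),
      Inst G r prems τ₂ ∧ τ₁ = prems i := by
  induction D with
  | node r prems σ hr sub ih =>
    rcases h with ⟨rfl, i, hi⟩ | ⟨i, hi⟩
    · exact ⟨r, _, prems, i, hr, hi⟩
    · exact ih i hi

theorem cl_of_reach {σ : Sequent} (D : Derivation G σ) {τ₁ τ₂ : Sequent}
    (h : ReflTransGen D.Step τ₁ τ₂) {A : Formula} (hA : Cl τ₂.lhs A) : Cl τ₁.lhs A := by
  induction h generalizing A with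
  | refl => exact hA
  | tail _ hs ih =>
    obtain ⟨r, n, prems, i, hr, rfl⟩ := D.exists_inst_of_step hs
    exact ih (hA.trans (hr.lhs_le i))

theorem not_cycle {σ : Sequent} (D : Derivation G σ) {τ : Sequent} (hτ : τ.IsRegular) :
    ¬ TransGen D.Step τ τ := by
  have key : ∀ τ', TransGen D.Step τ τ' →
      (∃ A, Cl τ.lhs A ∧ ¬ Cl τ'.lhs A) ∨ (τ'.IsRegular ∧ sizeOf τ.rhs < sizeOf τ'.rhs) := by
    intro τ' h
    induction h with
    | single hs =>
      obtain ⟨r, n, prems, i, hr, rfl⟩ := D.exists_inst_of_step hs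
      exact hr.of_regular i hτ
    | tail hp hs ih =>
      obtain ⟨r, n, prems, i, hr, rfl⟩ := D.exists_inst_of_step hs
      rcases ih with ⟨A, h₁, h₂⟩ | ⟨h₁, h₂⟩
      · exact Or.inl ⟨A, h₁, fun h => h₂ (h.trans (hr.lhs_le i))⟩
      · rcases hr.of_regular i h₁ with ⟨A, h₃, h₄⟩ | ⟨h₃, h₄⟩
        · exact Or.inl ⟨A, D.cl_of_reach hp.to_reflTransGen h₃, h₄⟩
        · exact Or.inr ⟨h₃, h₂.trans h₄⟩
  intro h
  rcases key τ h with ⟨A, h₁, h₂⟩ | ⟨_, h₁⟩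
  · exact h₂ h₁
  · exact lt_irrefl _ h₁

theorem isRegular_of_mem {σ : Sequent} (D : Derivation G σ) {τ : Sequent} (h : τ ∈ D.PSeq) :
    τ.IsRegular := by
  induction D with
  | node r prems σ hr sub ih =>
    rcases h with ⟨rfl, h, _⟩ | ⟨i, hi⟩
    · exact h
    · exact ih i hi

theorem finite_pSeq {σ : Sequent} (D : Derivation G σ) : D.PSeq.Finite := by
  induction D with
  | node r prems σ hr sub ih =>
    refine ((Set.finite_singleton σ).union (Set.finite_iUnion ih)).subset ?_
    rintro τ (⟨rfl, _⟩ | ⟨i, hi⟩)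
    · exact Or.inl rfl
    · exact Or.inr (Set.mem_iUnion.2 ⟨i, hi⟩)

theorem reach_sub {n : ℕ} {r : Rule} {prems : Fin n → Sequent} {σ : Sequent}
    {h : Inst G r prems σ} {sub : ∀ i, Derivation G (prems i)} (i : Fin n) {τ₁ τ₂ : Sequent}
    (hs : ReflTransGen (sub i).Step τ₁ τ₂) : ReflTransGen (node r prems σ h sub).Step τ₁ τ₂ := by
  induction hs with
  | refl => exact .refl
  | tail _ h ih => exact ih.tail (Or.inr ⟨i, h⟩)

theorem reach_root {σ : Sequent} (D : Derivation G σ) {τ : Sequent} (h : τ ∈ D.PSeq) :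
    ReflTransGen D.Step τ σ := by
  induction D with
  | node r prems σ hr sub ih =>
    rcases h with ⟨rfl, _⟩ | ⟨i, hi⟩
    · exact .refl
    · exact (reach_sub i (ih i hi)).tail (Or.inl ⟨rfl, i, rfl⟩)

theorem exists_min {σ : Sequent} (D : Derivation G σ) (hσ : σ.IsRegular) :
    ∃ ρ ∈ D.PSeq, ∀ τ ∈ D.PSeq, ReflTransGen D.Step τ ρ := by
  induction D with
  | node r prems σ hr sub ih =>
    by_cases hp : r.IsPrime
    · exact ⟨σ, Or.inl ⟨rfl, hσ, hp⟩, fun τ hτ => reach_root _ hτ⟩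
    · have hone : ∃ i, (prems i).IsRegular ∧ ∀ j, j = i := by
        cases hr with
        | axReg => exact (hp trivial).elim
        | axIrr => exact hσ.elim
        | andReg₁ => exact ⟨0, trivial, fun j => Subsingleton.elim _ _⟩
        | andReg₂ => exact ⟨0, trivial, fun j => Subsingleton.elim _ _⟩
        | andIrr₁ => exact hσ.elim
        | andIrr₂ => exact hσ.elim
        | or => exact hσ.elim
        | impInReg => exact ⟨0, trivial, fun j => Subsingleton.elim _ _⟩
        | impInIrr => exact hσ.elim
        | impNotIn => exact hσ.elim
        | joinAt => exact (hp trivial).elim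
        | joinOr => exact (hp trivial).elim
      obtain ⟨i, hi, huniq⟩ := hone
      obtain ⟨ρ, hρ, hmin⟩ := ih i hi
      refine ⟨ρ, Or.inr ⟨i, hρ⟩, ?_⟩
      rintro τ (⟨_, _, h⟩ | ⟨j, hj⟩)
      · exact (hp h).elim
      · obtain rfl := huniq j
        exact reach_sub j (hmin τ hj)

/-- The order on the p-sequents of `D`: `σ₁ ≤ σ₂` iff `σ₁` is reached from `σ₂` by going down
along the rule applications occurring in `D`. -/
@[reducible] def pOrder {σ : Sequent} (D : Derivation G σ) : PartialOrder D.PSeq where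
  le σ₁ σ₂ := ReflTransGen D.Step σ₂.1 σ₁.1
  le_refl _ := .refl
  le_trans _ _ _ h₁ h₂ := h₂.trans h₁
  le_antisymm a b h₁ h₂ := by
    apply Subtype.ext
    rcases reflTransGen_iff_eq_or_transGen.1 h₁ with h | h
    · exact h
    · exact (D.not_cycle (D.isRegular_of_mem b.2) (h.trans_left h₂)).elim

/-- The model `Mod(D)` extracted from a derivation `D` of a regular sequent: its worlds are the
p-sequents of `D`, its root is their minimum, and a variable holds at `σ` iff it is a left formula
of `σ`. -/
noncomputable def toModel {Γ : Set Formula} {C : Formula} (D : Derivation G (.reg Γ C)) :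
    KripkeModel where
  World := D.PSeq
  order := D.pOrder
  finite := D.finite_pSeq.to_subtype
  root := ⟨(D.exists_min trivial).choose, (D.exists_min trivial).choose_spec.1⟩
  root_le a := (D.exists_min trivial).choose_spec.2 a.1 a.2
  val σ := {p | Formula.var p ∈ σ.1.lhs}
  val_mono h _ hp := (D.cl_of_reach h (.base hp)).var_mem

end Derivation

end FRJ

/-!
A countermodel `K` for `G` is turned into a derivation that has, on every branch, at most one more
world than a longest chain of `K` has steps, and every derivation yields a countermodel.

Soundness (`Derivation.world_spec`). By induction downwards along the order of the extracted model,
every world forces its left formulas and refutes its right formula. At a world `w` concluded by a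
join, the premises `S ; T → A` satisfy `S ⊆ lhs w ⊆ S ∪ T`. This bracketing survives on going up
through irregular sequents, and shows that `w` refutes their right formulas. A left implication of
`w` has its antecedent among the right formulas of the premises, so it holds at `w` itself, and at
the worlds above because left formulas persist up to closure. Both facts need each other, so they
are proved by induction on the size of formulas.

Completeness (`regDerivable_of_worldHeight_le`). Attach to a world `a` of `K` its core: the forced
left variables, and the forced left implications `Y ⊃ Z` with `Y` not forced. All forced left
formulas lie in the closure of the core. By induction on the height of `a`, every right formula not
forced at `a` is the right formula of an irregular sequent bracketing the core
(`irrDerivable_of_above`), where only implications with unforced antecedent use a world above `a`;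
joining these sequents gives a regular sequent at the cost of one new world
(`regDerivable_of_above`).

Height. A world of the extracted model is a sequent, not an occurrence of one, so a chain of worlds
may jump between branches, and the height of a derivation tree need not bound the height of the
model. The remedy is `derivRank`, the least number of worlds on a branch over all derivations of a
sequent: `DerivableIn.exists_derivation` provides a derivation in which the rank never decreases
along a step and increases at every world, which bounds the length of all chains.
-/

namespace FRJ

/-! ### Forcing, closure and subformulas -/

namespace KripkeModel

theorem Forces.mono {K : KripkeModel} {a b : K.World} (hab : a ≤ b) {A : Formula}
    (h : K.Forces a A) : K.Forces b A := by
  induction A with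
  | var p => exact K.val_mono hab h
  | bot => exact h.elim
  | and A B ihA ihB => exact ⟨ihA h.1, ihB h.2⟩
  | or A B ihA ihB => exact h.imp ihA ihB
  | imp A B => exact fun c hc => h c (hab.trans hc)

theorem exists_of_not_forces_imp {K : KripkeModel} {a : K.World} {A B : Formula}
    (h : ¬ K.Forces a (.imp A B)) : ∃ b, a ≤ b ∧ K.Forces b A ∧ ¬ K.Forces b B := by
  by_contra! hcon
  refine h fun b hb => ?_
  by_cases hA : K.Forces b A
  · exact Or.inr (hcon b hb hA)
  · exact Or.inl hA

/-- Forcing passes from `Γ` to its closure. Only the members of `Γ` that are no larger than the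
formula matter, which makes the lemma usable in inductions on the size of formulas. -/
theorem forces_of_cl {K : KripkeModel} {a : K.World} {Γ : Set Formula} {A : Formula}
    (hA : Cl Γ A) (h : ∀ X ∈ Γ, sizeOf X ≤ sizeOf A → K.Forces a X) : K.Forces a A := by
  induction hA with
  | base hC => exact h _ hC le_rfl
  | and _ _ ih₁ ih₂ =>
    exact ⟨ih₁ fun X hX hs => h X hX (by simp; omega),
      ih₂ fun X hX hs => h X hX (by simp; omega)⟩
  | or_right _ ih => exact Or.inr (ih fun X hX hs => h X hX (by simp; omega))
  | or_left _ ih => exact Or.inl (ih fun X hX hs => h X hX (by simp; omega))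
  | imp _ ih =>
    exact fun b hb => Or.inr ((ih fun X hX hs => h X hX (by simp; omega)).mono hb)

end KripkeModel

theorem Cl.mono {Γ Δ : Set Formula} (h : Γ ⊆ Δ) {A : Formula} (hA : Cl Γ A) : Cl Δ A :=
  hA.trans fun _ hX => .base (h hX)

theorem finite_setOf_signedSub (G : Formula) : {A | ∃ s, SignedSub G s A}.Finite := by
  -- The subformulas of any formula lie in a finite set closed under immediate subformulas.
  have key : ∃ U : Set Formula, U.Finite ∧ G ∈ U ∧
      (∀ A B, .and A B ∈ U → A ∈ U ∧ B ∈ U) ∧ (∀ A B, .or A B ∈ U → A ∈ U ∧ B ∈ U) ∧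
      (∀ A B, .imp A B ∈ U → A ∈ U ∧ B ∈ U) := by
    induction G with
    | var p => exact ⟨{.var p}, by simp⟩
    | bot => exact ⟨{.bot}, by simp⟩
    | and A B ihA ihB =>
      obtain ⟨U, hU, hA, h⟩ := ihA
      obtain ⟨V, hV, hB, h'⟩ := ihB
      exact ⟨insert (.and A B) (U ∪ V), (hU.union hV).insert _, by grind⟩
    | or A B ihA ihB =>
      obtain ⟨U, hU, hA, h⟩ := ihA
      obtain ⟨V, hV, hB, h'⟩ := ihB
      exact ⟨insert (.or A B) (U ∪ V), (hU.union hV).insert _, by grind⟩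
    | imp A B ihA ihB =>
      obtain ⟨U, hU, hA, h⟩ := ihA
      obtain ⟨V, hV, hB, h'⟩ := ihB
      exact ⟨insert (.imp A B) (U ∪ V), (hU.union hV).insert _, by grind⟩
  obtain ⟨U, hU, hG, hand, hor, himp⟩ := key
  refine hU.subset ?_
  rintro A ⟨s, h⟩
  induction h with
  | self => exact hG
  | and_left _ ih => exact (hand _ _ ih).1
  | and_right _ ih => exact (hand _ _ ih).2
  | or_left _ ih => exact (hor _ _ ih).1
  | or_right _ ih => exact (hor _ _ ih).2
  | imp_left _ ih => exact (himp _ _ ih).1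
  | imp_right _ ih => exact (himp _ _ ih).2

theorem finite_Sl (G : Formula) : (Sl G).Finite :=
  (finite_setOf_signedSub G).subset fun _ h => ⟨_, h⟩

theorem finite_Sr (G : Formula) : (Sr G).Finite :=
  (finite_setOf_signedSub G).subset fun _ h => ⟨_, h⟩

theorem bar_subset_Sl (G : Formula) : bar G ⊆ Sl G :=
  Set.union_subset Set.inter_subset_left Set.inter_subset_left

/-! ### Worlds of a derivation and the rules producing them -/

@[simp]
theorem and_notMem_primes (A B : Formula) : .and A B ∉ primes := by simp [primes, atoms]

@[simp]
theorem or_notMem_primes (A B : Formula) : .or A B ∉ primes := by simp [primes, atoms]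

@[simp]
theorem imp_notMem_primes (A B : Formula) : .imp A B ∉ primes := by simp [primes, atoms]

theorem mem_join_or {n : ℕ} {S T : Fin n → Set Formula} {A : Fin n → Formula} {X : Formula}
    (hX : X ∈ sigmaAt S ∪ thetaAt T ∪ sigmaImp S ∪ thetaImp T A) (j : Fin n) :
    (∃ i, X ∈ S i) ∨ X ∈ T j := by
  rcases hX with ((hX | hX) | hX) | hX
  · obtain ⟨i, hi⟩ := Set.mem_iUnion.1 hX
    exact Or.inl ⟨i, hi.1⟩
  · exact Or.inr (hX j).1
  · obtain ⟨i, hi⟩ := Set.mem_iUnion.1 hX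
    exact Or.inl ⟨i, hi.1⟩
  · exact Or.inr (hX.1 j).1

theorem joinAt_subset {n : ℕ} {S T : Fin n → Set Formula} {A : Fin n → Formula} {F : Formula} :
    sigmaAt S ∪ (thetaAt T \ {F}) ∪ sigmaImp S ∪ thetaImp T A ⊆
      sigmaAt S ∪ thetaAt T ∪ sigmaImp S ∪ thetaImp T A := by
  gcongr
  exact Set.sdiff_subset

theorem Inst.lhs_subset_bar {G : Formula} {r : Rule} {n : ℕ} {prems : Fin n → Sequent}
    {σ : Sequent} (h : Inst G r prems σ) (hp : ∀ i, (prems i).lhs ⊆ bar G) : σ.lhs ⊆ bar G := by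
  have join : ∀ {m : ℕ} {S T : Fin m → Set Formula} {A : Fin m → Formula}, 1 ≤ m →
      (∀ i, S i ∪ T i ⊆ bar G) →
      sigmaAt S ∪ thetaAt T ∪ sigmaImp S ∪ thetaImp T A ⊆ bar G := by
    intro m S T A hm hb X hX
    rcases mem_join_or hX ⟨0, hm⟩ with ⟨i, hi⟩ | hT
    · exact hb i (Or.inl hi)
    · exact hb _ (Or.inr hT)
  cases h with
  | axReg => exact fun X hX => Or.inl hX.1
  | axIrr =>
    rintro X (hX | hX | hX)
    · exact hX.elim
    · exact Or.inl hX.1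
    · exact Or.inr hX
  | andReg₁ => exact hp 0
  | andReg₂ => exact hp 0
  | andIrr₁ => exact hp 0
  | andIrr₂ => exact hp 0
  | or =>
    have h0 := hp 0
    have h1 := hp 1
    simp only [Sequent.lhs, Matrix.cons_val_zero, Matrix.cons_val_one] at h0 h1 ⊢
    rintro X ((hX | hX) | hX)
    · exact h0 (Or.inl hX)
    · exact h1 (Or.inl hX)
    · exact h0 (Or.inr hX.1)
  | impInReg => exact hp 0
  | impInIrr =>
    have h0 := hp 0
    simp only [Sequent.lhs, Matrix.cons_val_zero] at h0 ⊢
    rintro X ((hX | hX) | hX)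
    · exact h0 (Or.inl hX)
    · exact h0 (Or.inr (Or.inr hX))
    · exact h0 (Or.inr (Or.inl hX))
  | impNotIn _ hT =>
    rintro X (hX | hX)
    · exact hX.elim
    · exact (hT hX).2
  | joinAt hn => exact joinAt_subset.trans (join hn hp)
  | joinOr hn => exact join hn hp

/-- The premises of a join bracket the left-hand side of its conclusion, and every implication in
that left-hand side has an antecedent among their right formulas. The set `Δ` covers both join
rules. -/
theorem join_bracket {n : ℕ} {S T : Fin n → Set Formula} {A : Fin n → Formula} {Δ : Set Formula}
    {G : Formula} (hn : 1 ≤ n) (hJ : JoinCond S T A) (hb : ∀ j, S j ⊆ bar G)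
    (h₁ : sigmaAt S ∪ sigmaImp S ⊆ Δ)
    (h₂ : Δ ⊆ sigmaAt S ∪ thetaAt T ∪ sigmaImp S ∪ thetaImp T A) :
    (∀ j, S j ⊆ Δ ∧ Δ ⊆ S j ∪ T j) ∧ ∀ Y Z, .imp Y Z ∈ Δ → ∃ j, A j = Y := by
  refine ⟨fun j => ⟨fun X hX => h₁ ?_, fun X hX => ?_⟩, fun Y Z h => ?_⟩
  · rcases hb j hX with h | h
    · exact Or.inl (Set.mem_iUnion.2 ⟨j, hX, h.2⟩)
    · exact Or.inr (Set.mem_iUnion.2 ⟨j, hX, h.2⟩)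
  · rcases mem_join_or (h₂ hX) j with ⟨i, hi⟩ | h
    · by_cases hij : i = j
      · exact Or.inl (hij ▸ hi)
      · exact hJ.1 i j hij hi
    · exact Or.inr h
  · rcases h₂ h with ((h | h) | h) | ⟨-, _, _, h, h'⟩
    · obtain ⟨j, -, _, hj⟩ := Set.mem_iUnion.1 h
      cases hj
    · obtain ⟨_, hj⟩ := (h ⟨0, hn⟩).2
      cases hj
    · exact hJ.2 Y Z h
    · cases h
      exact h'

/-- The number of worlds contributed by a sequent of a derivation: `1` for a regular sequent that
can be the conclusion of an axiom or join rule, and `0` otherwise. For a derivable regular sequent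
the shape of the right formula decides which. -/
def Sequent.worldCost : Sequent → ℕ
  | .reg _ (.var _) => 1
  | .reg _ .bot => 1
  | .reg _ (.or _ _) => 1
  | _ => 0

theorem Sequent.worldCost_of_mem_primes {Γ : Set Formula} {F : Formula} (h : F ∈ primes) :
    (Sequent.reg Γ F).worldCost = 1 := by
  rcases h with ⟨p, rfl⟩ | rfl <;> rfl

theorem Inst.worldCost_of_isPrime {G : Formula} {r : Rule} {n : ℕ} {prems : Fin n → Sequent}
    {σ : Sequent} (h : Inst G r prems σ) (hσ : σ.IsRegular) (hr : r.IsPrime) :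
    σ.worldCost = 1 := by
  cases h with
  | axReg hF => exact Sequent.worldCost_of_mem_primes hF
  | joinAt _ _ _ hF => exact Sequent.worldCost_of_mem_primes hF
  | joinOr => rfl
  | axIrr => exact hσ.elim
  | _ => exact hr.elim

/-- What the rules deriving a world provide: the antecedent of every left implication is the right
formula of a premise bracketing the left-hand side, and the right formula is a prime formula missing
on the left or a disjunction of right formulas of such premises. -/
theorem Inst.of_worldCost {G : Formula} {r : Rule} {n : ℕ} {prems : Fin n → Sequent}
    {σ : Sequent} (h : Inst G r prems σ) (hσ : σ.worldCost = 1)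
    (hb : ∀ i, (prems i).lhs ⊆ bar G) :
    (∀ Y Z, .imp Y Z ∈ σ.lhs → ∃ S T i, prems i = .irr S T Y ∧ S ⊆ σ.lhs ∧ σ.lhs ⊆ S ∪ T) ∧
    ((σ.rhs ∈ primes ∧ σ.rhs ∉ σ.lhs) ∨ ∃ C₁ C₂, σ.rhs = .or C₁ C₂ ∧
      (∃ S T i, prems i = .irr S T C₁ ∧ S ⊆ σ.lhs ∧ σ.lhs ⊆ S ∪ T) ∧
      (∃ S T i, prems i = .irr S T C₂ ∧ S ⊆ σ.lhs ∧ σ.lhs ⊆ S ∪ T)) := by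
  cases h with
  | axReg hF =>
    refine ⟨fun Y Z h => ?_, Or.inl ⟨hF, fun h => h.2 rfl⟩⟩
    obtain ⟨_, h⟩ := h.1.2
    cases h
  | @joinAt n S T A F hn _ hJ hF hFS =>
    have hΔ : sigmaAt S ∪ sigmaImp S ⊆
        sigmaAt S ∪ (thetaAt T \ {F}) ∪ sigmaImp S ∪ thetaImp T A :=
      fun X hX => hX.elim (fun h => Or.inl (Or.inl (Or.inl h))) (fun h => Or.inl (Or.inr h))
    obtain ⟨h₁, h₂⟩ := join_bracket hn hJ (fun j => Set.subset_union_left.trans (hb j)) hΔ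
      joinAt_subset
    refine ⟨fun Y Z h => ?_, Or.inl ⟨hF, ?_⟩⟩
    · obtain ⟨j, rfl⟩ := h₂ Y Z h
      exact ⟨_, _, j, rfl, h₁ j⟩
    · rintro (((h | h) | h) | ⟨-, _, _, rfl, -⟩)
      · exact hFS h
      · exact h.2 rfl
      · obtain ⟨j, -, _, _, rfl⟩ := Set.mem_iUnion.1 h
        simp at hF
      · simp at hF
  | @joinOr n S T A C₁ C₂ hn _ hJ hC₁ hC₂ =>
    have hΔ : sigmaAt S ∪ sigmaImp S ⊆ sigmaAt S ∪ thetaAt T ∪ sigmaImp S ∪ thetaImp T A :=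
      fun X hX => hX.elim (fun h => Or.inl (Or.inl (Or.inl h))) (fun h => Or.inl (Or.inr h))
    obtain ⟨h₁, h₂⟩ := join_bracket hn hJ (fun j => Set.subset_union_left.trans (hb j)) hΔ
      subset_rfl
    refine ⟨fun Y Z h => ?_, Or.inr ⟨C₁, C₂, rfl, ?_, ?_⟩⟩
    · obtain ⟨j, rfl⟩ := h₂ Y Z h
      exact ⟨_, _, j, rfl, h₁ j⟩
    · obtain ⟨j, rfl⟩ := hC₁
      exact ⟨_, _, j, rfl, h₁ j⟩
    · obtain ⟨j, rfl⟩ := hC₂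
      exact ⟨_, _, j, rfl, h₁ j⟩
  | _ => cases hσ

/-! ### The extracted model refutes the root formula -/

namespace Derivation

open Relation

variable {G : Formula}

/-- `D.Occ τ`: the sequent `τ` occurs in `D`. -/
def Occ {σ : Sequent} (D : Derivation G σ) (τ : Sequent) : Prop := τ = σ ∨ ∃ τ', D.Step τ τ'

theorem Occ.of_sub {n : ℕ} {r : Rule} {prems : Fin n → Sequent} {σ : Sequent}
    {h : Inst G r prems σ} {sub : ∀ i, Derivation G (prems i)} (i : Fin n) {τ : Sequent}
    (hτ : (sub i).Occ τ) : (node r prems σ h sub).Occ τ := by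
  rcases hτ with rfl | ⟨τ', hs⟩
  · exact Or.inr ⟨σ, Or.inl ⟨rfl, i, rfl⟩⟩
  · exact Or.inr ⟨τ', Or.inr ⟨i, hs⟩⟩

theorem occ_node_iff {n : ℕ} {r : Rule} {prems : Fin n → Sequent} {σ : Sequent}
    {h : Inst G r prems σ} {sub : ∀ i, Derivation G (prems i)} {τ : Sequent} :
    (node r prems σ h sub).Occ τ ↔ τ = σ ∨ ∃ i, (sub i).Occ τ := by
  constructor
  · rintro (rfl | ⟨τ', ⟨_, i, hi⟩ | ⟨i, hi⟩⟩)
    · exact Or.inl rfl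
    · exact Or.inr ⟨i, Or.inl hi⟩
    · exact Or.inr ⟨i, Or.inr ⟨τ', hi⟩⟩
  · rintro (rfl | ⟨i, hi⟩)
    · exact Or.inl rfl
    · exact hi.of_sub i

theorem occ_of_mem {σ : Sequent} (D : Derivation G σ) {τ : Sequent} (h : τ ∈ D.PSeq) :
    D.Occ τ := by
  induction D with
  | node r prems σ hr sub ih =>
    rcases h with ⟨rfl, _⟩ | ⟨i, hi⟩
    · exact Or.inl rfl
    · exact (ih i hi).of_sub i

theorem worldCost_of_mem {σ : Sequent} (D : Derivation G σ) {τ : Sequent} (h : τ ∈ D.PSeq) :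
    τ.worldCost = 1 := by
  induction D with
  | node r prems σ hr sub ih =>
    rcases h with ⟨rfl, h₁, h₂⟩ | ⟨i, hi⟩
    · exact hr.worldCost_of_isPrime h₁ h₂
    · exact ih i hi

theorem Occ.exists_inst {σ : Sequent} {D : Derivation G σ} {τ : Sequent} (h : D.Occ τ) :
    ∃ (r : Rule) (n : ℕ) (prems : Fin n → Sequent), Inst G r prems τ ∧
      (∀ i, D.Occ (prems i) ∧ D.Step (prems i) τ) ∧
      (τ.IsRegular → r.IsPrime → τ ∈ D.PSeq) := by
  induction D with
  | node r prems σ hr sub ih =>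
    rcases occ_node_iff.1 h with rfl | ⟨i, hi⟩
    · exact ⟨r, _, prems, hr, fun i => ⟨Occ.of_sub i (Or.inl rfl), Or.inl ⟨rfl, i, rfl⟩⟩,
        fun h₁ h₂ => Or.inl ⟨rfl, h₁, h₂⟩⟩
    · obtain ⟨r', m, prems', h₁, h₂, h₃⟩ := ih i hi
      exact ⟨r', m, prems', h₁, fun j => ⟨(h₂ j).1.of_sub i, Or.inr ⟨i, (h₂ j).2⟩⟩,
        fun h h' => Or.inr ⟨i, h₃ h h'⟩⟩

theorem Occ.lhs_subset_bar {σ : Sequent} {D : Derivation G σ} {τ : Sequent} (h : D.Occ τ) :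
    τ.lhs ⊆ bar G := by
  have root : ∀ {σ : Sequent}, Derivation G σ → σ.lhs ⊆ bar G := by
    intro σ D
    induction D with
    | node r prems σ hr sub ih => exact hr.lhs_subset_bar ih
  induction D with
  | node r prems σ hr sub ih =>
    rcases occ_node_iff.1 h with rfl | ⟨i, hi⟩
    · exact root (node r prems τ hr sub)
    · exact ih i hi

variable {Γ₀ : Set Formula} {C₀ : Formula} (D : Derivation G (.reg Γ₀ C₀))

/-- A regular sequent `Γ ⇒ C` in `D` is obtained from a world with the same left formulas by rules
that do not affect the left-hand side; if that world forces `Γ` and refutes its own right formula,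
it also refutes `C`. -/
theorem exists_world_of_occ {Γ : Set Formula} {C : Formula} (h : D.Occ (.reg Γ C)) :
    ∃ w : D.toModel.World, w.1.lhs = Γ ∧ ReflTransGen D.Step w.1 (.reg Γ C) ∧
      ((∀ X ∈ Γ, D.toModel.Forces w X) → ¬ D.toModel.Forces w w.1.rhs →
        ¬ D.toModel.Forces w C) := by
  induction C with
  | var p =>
    obtain ⟨r, n, prems, hr, hp, hP⟩ := h.exists_inst
    have : r.IsPrime := by cases hr <;> trivial
    exact ⟨⟨_, hP trivial this⟩, rfl, .refl, fun _ h => h⟩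
  | bot =>
    obtain ⟨r, n, prems, hr, hp, hP⟩ := h.exists_inst
    have : r.IsPrime := by cases hr <;> trivial
    exact ⟨⟨_, hP trivial this⟩, rfl, .refl, fun _ h => h⟩
  | or A B =>
    obtain ⟨r, n, prems, hr, hp, hP⟩ := h.exists_inst
    have : r.IsPrime := by cases hr <;> trivial
    exact ⟨⟨_, hP trivial this⟩, rfl, .refl, fun _ h => h⟩
  | and A B ihA ihB =>
    obtain ⟨r, n, prems, hr, hp, -⟩ := h.exists_inst
    cases hr with
    | axReg hF => simp at hF
    | joinAt _ _ _ hF => simp at hF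
    | andReg₁ =>
      obtain ⟨w, h₁, h₂, h₃⟩ := ihA (hp 0).1
      exact ⟨w, h₁, h₂.tail (hp 0).2, fun h h' hAB => h₃ h h' hAB.1⟩
    | andReg₂ =>
      obtain ⟨w, h₁, h₂, h₃⟩ := ihB (hp 0).1
      exact ⟨w, h₁, h₂.tail (hp 0).2, fun h h' hAB => h₃ h h' hAB.2⟩
  | imp A B ihA ihB =>
    obtain ⟨r, n, prems, hr, hp, -⟩ := h.exists_inst
    cases hr with
    | axReg hF => simp at hF
    | joinAt _ _ _ hF => simp at hF
    | impInReg _ hA =>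
      obtain ⟨w, h₁, h₂, h₃⟩ := ihB (hp 0).1
      refine ⟨w, h₁, h₂.tail (hp 0).2, fun h h' hAB => ?_⟩
      rcases hAB w le_rfl with hn | hB
      · exact hn (KripkeModel.forces_of_cl hA fun X hX _ => h X hX)
      · exact h₃ h h' hB

/-- Suppose the worlds above `w` force their left formulas and refute their right formulas, and
that `w` forces its left formulas smaller than `C`. Then `w` refutes the right formula `C` of every
irregular sequent `S ; T → C` that leads down to `w` and whose left-hand side brackets that of
`w`. -/
theorem not_forces_of_irr {w : D.toModel.World}
    (hup : ∀ w' : D.toModel.World, w < w' →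
      (∀ X ∈ w'.1.lhs, D.toModel.Forces w' X) ∧ ¬ D.toModel.Forces w' w'.1.rhs)
    {C : Formula} {S T : Set Formula} (hocc : D.Occ (.irr S T C))
    (hreach : ReflTransGen D.Step (.irr S T C) w.1) (hS : S ⊆ w.1.lhs) (hT : w.1.lhs ⊆ S ∪ T)
    (hsmall : ∀ X ∈ w.1.lhs, sizeOf X < sizeOf C → D.toModel.Forces w X) :
    ¬ D.toModel.Forces w C := by
  induction C generalizing S T with
  | var p =>
    obtain ⟨r, n, prems, hr, hp, -⟩ := hocc.exists_inst
    cases hr with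
    | axIrr =>
      intro h
      rcases hT h with h | h | h
      · exact h
      · exact h.2 rfl
      · obtain ⟨_, _, h⟩ := h.2
        cases h
  | bot => exact id
  | and A B ihA ihB =>
    obtain ⟨r, n, prems, hr, hp, -⟩ := hocc.exists_inst
    cases hr with
    | axIrr hF => simp at hF
    | andIrr₁ =>
      exact fun h => ihA (hp 0).1 (hreach.head (hp 0).2) hS hT
        (fun X hX hs => hsmall X hX (by simp; omega)) h.1
    | andIrr₂ =>
      exact fun h => ihB (hp 0).1 (hreach.head (hp 0).2) hS hT
        (fun X hX hs => hsmall X hX (by simp; omega)) h.2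
  | or A B ihA ihB =>
    obtain ⟨r, n, prems, hr, hp, -⟩ := hocc.exists_inst
    cases hr with
    | axIrr hF => simp at hF
    | or _ h₁ h₂ =>
      rintro (h | h)
      · refine ihA (hp 0).1 (hreach.head (hp 0).2) (Set.subset_union_left.trans hS) ?_
          (fun X hX hs => hsmall X hX (by simp; omega)) h
        intro X hX
        rcases hT hX with (hX | hX) | hX
        · exact Or.inl hX
        · exact h₂ hX
        · exact Or.inr hX.1
      · refine ihB (hp 1).1 (hreach.head (hp 1).2) (Set.subset_union_right.trans hS) ?_
          (fun X hX hs => hsmall X hX (by simp; omega)) h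
        intro X hX
        rcases hT hX with (hX | hX) | hX
        · exact h₁ hX
        · exact Or.inl hX
        · exact Or.inr hX.2
  | imp A B ihA ihB =>
    obtain ⟨r, n, prems, hr, hp, -⟩ := hocc.exists_inst
    cases hr with
    | axIrr hF => simp at hF
    | @impInIrr S T L _ _ _ _ hA _ =>
      intro h
      rcases h w le_rfl with h | h
      · exact h (KripkeModel.forces_of_cl hA fun X hX hs =>
          hsmall X (hS hX) (by simp; omega))
      · refine ihB (hp 0).1 (hreach.head (hp 0).2) (Set.subset_union_left.trans hS) ?_
          (fun X hX hs => hsmall X hX (by simp; omega)) h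
        intro X hX
        rcases hT hX with (hX | hX) | hX
        · exact Or.inl hX
        · exact Or.inr (Or.inr hX)
        · exact Or.inr (Or.inl hX)
    | impNotIn _ hTΓ hA hnA _ =>
      intro h
      obtain ⟨w', h₁, h₂, h₃⟩ := D.exists_world_of_occ (hp 0).1
      have hle : w ≤ w' := (h₂.tail (hp 0).2).trans hreach
      -- The antecedent separates the two worlds: it lies in the closure of `w'`, not of `w`.
      have hlt : w < w' := by
        refine lt_of_le_of_ne hle ?_
        rintro rfl
        refine hnA (hA.trans fun X hX => ?_)
        rw [← h₁] at hX
        exact .base ((hT hX).resolve_left id)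
      obtain ⟨h₄, h₅⟩ := hup w' hlt
      rw [h₁] at h₄
      rcases h w' hle with h | h
      · exact h (KripkeModel.forces_of_cl hA fun X hX _ => h₄ X hX)
      · exact h₃ h₄ h₅ h

/-- Every world of the extracted model forces its left formulas and refutes its right formula. -/
theorem world_spec (w : D.toModel.World) :
    (∀ X ∈ w.1.lhs, D.toModel.Forces w X) ∧ ¬ D.toModel.Forces w w.1.rhs := by
  have : WellFoundedGT D.toModel.World := Finite.to_wellFoundedGT
  induction w using WellFoundedGT.induction with
  | ind w hup =>
  have hocc := D.occ_of_mem w.2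
  have hbar := hocc.lhs_subset_bar
  -- A left implication with refuted antecedent is forced: above `w` it lies in the closure of the
  -- left formulas.
  have himp : ∀ Y Z, .imp Y Z ∈ w.1.lhs → ¬ D.toModel.Forces w Y →
      D.toModel.Forces w (.imp Y Z) := by
    intro Y Z hX hY b hb
    rcases hb.eq_or_lt with rfl | hlt
    · exact Or.inl hY
    · refine KripkeModel.forces_of_cl (D.cl_of_reach hb (.base hX))
        (fun X hX _ => (hup b hlt).1 X hX) b le_rfl
  -- Hence it is enough to refute the antecedents of left implications, by induction on size.
  have hall : (∀ Y Z, .imp Y Z ∈ w.1.lhs →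
      (∀ X ∈ w.1.lhs, sizeOf X < sizeOf Y → D.toModel.Forces w X) → ¬ D.toModel.Forces w Y) →
      ∀ X ∈ w.1.lhs, D.toModel.Forces w X := by
    intro h
    have : ∀ n, ∀ X ∈ w.1.lhs, sizeOf X = n → D.toModel.Forces w X := by
      intro n
      induction n using Nat.strong_induction_on with
      | _ n ih =>
        rintro X hX rfl
        rcases hbar hX with ⟨_, p, rfl⟩ | ⟨_, Y, Z, rfl⟩
        · exact hX
        · exact himp Y Z hX (h Y Z hX fun X' hX' hs => ih _ (by simp; omega) X' hX' rfl)
    exact fun X hX => this _ X hX rfl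
  obtain ⟨r, n, prems, hr, hp, -⟩ := hocc.exists_inst
  obtain ⟨h₁, h₂⟩ := hr.of_worldCost (D.worldCost_of_mem w.2) fun i => (hp i).1.lhs_subset_bar
  have hirr : ∀ C, (∃ S T i, prems i = .irr S T C ∧ S ⊆ w.1.lhs ∧ w.1.lhs ⊆ S ∪ T) →
      (∀ X ∈ w.1.lhs, sizeOf X < sizeOf C → D.toModel.Forces w X) →
      ¬ D.toModel.Forces w C := by
    rintro C ⟨S, T, i, hi, hS, hT⟩
    exact D.not_forces_of_irr hup (hi ▸ (hp i).1) (hi ▸ .single (hp i).2) hS hT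
  have hlhs := hall fun Y Z h => hirr Y (h₁ Y Z h)
  refine ⟨hlhs, ?_⟩
  rcases h₂ with ⟨⟨p, hF⟩ | hF, hn⟩ | ⟨C₁, C₂, hC, hC₁, hC₂⟩
  · rw [hF] at hn ⊢
    exact hn
  · rw [Set.mem_singleton_iff.1 hF]
    exact id
  · rw [hC]
    rintro (h | h)
    · exact hirr _ hC₁ (fun X hX _ => hlhs X hX) h
    · exact hirr _ hC₂ (fun X hX _ => hlhs X hX) h

theorem toModel_isCountermodel (D : Derivation G (.reg Γ₀ G)) : D.toModel.IsCountermodel G := by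
  intro h
  obtain ⟨w, h₁, -, h₃⟩ := D.exists_world_of_occ (Or.inl rfl)
  obtain ⟨h₄, h₅⟩ := D.world_spec w
  rw [h₁] at h₄
  exact h₃ h₄ h₅ (h.mono (D.toModel.root_le w))

end Derivation

/-! ### Derivability with a bound on the number of worlds along a branch -/

/-- `DerivableIn G n σ`: the sequent `σ` has a derivation in which every branch contains at most
`n` sequents of cost `1`, that is, at most `n` worlds. -/
inductive DerivableIn (G : Formula) : ℕ → Sequent → Prop
  | node {r : Rule} {m : ℕ} {prems : Fin m → Sequent} {σ : Sequent} {n k : ℕ} :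
      Inst G r prems σ → (∀ i, DerivableIn G n (prems i)) → n + σ.worldCost ≤ k →
      DerivableIn G k σ

namespace DerivableIn

variable {G : Formula}

theorem mono {n k : ℕ} {σ : Sequent} (h : DerivableIn G n σ) (hnk : n ≤ k) :
    DerivableIn G k σ := by
  cases h with
  | node hr hp hn => exact .node hr hp (hn.trans hnk)

theorem axiom_rule {r : Rule} {prems : Fin 0 → Sequent} {σ : Sequent} (h : Inst G r prems σ) :
    DerivableIn G σ.worldCost σ := .node (n := 0) h (fun i => i.elim0) (by simp)

theorem unary {n : ℕ} {r : Rule} {τ σ : Sequent} (h : Inst G r ![τ] σ) (hσ : σ.worldCost = 0)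
    (hτ : DerivableIn G n τ) : DerivableIn G n σ :=
  .node h (fun i => by fin_cases i; exact hτ) (by simp [hσ])

end DerivableIn

/-- The least `n` such that `σ` has a derivation with at most `n` worlds on every branch (and `0`
if `σ` is not derivable). -/
noncomputable def derivRank (G : Formula) (σ : Sequent) : ℕ := sInf {n | DerivableIn G n σ}

theorem derivRank_le {G : Formula} {n : ℕ} {σ : Sequent} (h : DerivableIn G n σ) :
    derivRank G σ ≤ n := Nat.sInf_le h

theorem DerivableIn.derivRank {G : Formula} {n : ℕ} {σ : Sequent} (h : DerivableIn G n σ) :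
    DerivableIn G (derivRank G σ) σ := Nat.sInf_mem (s := {n | DerivableIn G n σ}) ⟨n, h⟩

/-- Every derivable sequent has a derivation along whose steps the rank grows by at least the cost
of the conclusion. Since the rank belongs to the sequent and not to an occurrence of it, this
controls also the paths of the extracted model that jump between occurrences of a sequent. -/
theorem DerivableIn.exists_derivation {G : Formula} {n : ℕ} {σ : Sequent}
    (h : DerivableIn G n σ) : ∃ D : Derivation G σ,
      (∀ τ₁ τ₂, D.Step τ₁ τ₂ → FRJ.derivRank G τ₁ + τ₂.worldCost ≤ FRJ.derivRank G τ₂) ∧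
      ∀ τ ∈ D.PSeq, 1 ≤ FRJ.derivRank G τ := by
  induction n using Nat.strong_induction_on generalizing σ with
  | _ n ih =>
    generalize hk : n = k at h
    have hkn : k ≤ n := hk.ge
    clear hk
    induction h with
    | @node r m prems σ n' k hr hp hk ihp =>
      rcases (derivRank_le (.node hr hp hk)).trans hkn |>.lt_or_eq with hlt | heq
      · exact ih _ hlt (DerivableIn.node hr hp hk).derivRank
      · choose sub hsub using fun i => ihp i (by omega)
        refine ⟨.node r prems σ hr sub, ?_, ?_⟩
        · rintro τ₁ τ₂ (⟨rfl, i, rfl⟩ | ⟨i, hi⟩)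
          · have := derivRank_le (hp i)
            omega
          · exact (hsub i).1 _ _ hi
        · rintro τ (⟨rfl, h₁, h₂⟩ | ⟨i, hi⟩)
          · have := hr.worldCost_of_isPrime h₁ h₂
            omega
          · exact (hsub i).2 _ hi

/-- The height of the extracted model is bounded by the number of worlds on the branches. -/
theorem DerivableIn.exists_toModel_height_le {G C : Formula} {Γ : Set Formula} {n : ℕ}
    (h : DerivableIn G (n + 1) (.reg Γ C)) :
    ∃ D : Derivation G (.reg Γ C), D.toModel.height ≤ n := by
  obtain ⟨D, hstep, hpos⟩ := h.exists_derivation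
  refine ⟨D, ?_⟩
  have hmono : ∀ τ₁ τ₂, Relation.ReflTransGen D.Step τ₁ τ₂ →
      FRJ.derivRank G τ₁ ≤ FRJ.derivRank G τ₂ := by
    intro τ₁ τ₂ h
    induction h with
    | refl => exact le_rfl
    | tail _ h ih => exact ih.trans (Nat.le_of_add_right_le (hstep _ _ h))
  -- The last step of a path between distinct worlds ends in a world, so it has positive cost.
  have hstrict : ∀ w w' : D.toModel.World, w < w' →
      FRJ.derivRank G w'.1 < FRJ.derivRank G w.1 := by
    intro w w' hlt
    rcases Relation.ReflTransGen.cases_tail hlt.le with h | ⟨τ, h, hs⟩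
    · exact absurd (Subtype.ext h) hlt.ne
    · have h₁ := hmono _ _ h
      have h₂ := hstep _ _ hs
      rw [D.worldCost_of_mem w.2] at h₂
      omega
  have key : ∀ m : ℕ, ∀ w : D.toModel.World, FRJ.derivRank G w.1 ≤ m + 1 →
      Order.coheight w ≤ m := by
    intro m
    induction m with
    | zero =>
      intro w hw
      refine Order.coheight_le_coe_iff.2 fun w' hlt => ?_
      have := hstrict w w' hlt
      have := hpos _ w'.2
      omega
    | succ m ih =>
      intro w hw
      refine Order.coheight_le_coe_iff.2 fun w' hlt => ?_
      have := hstrict w w' hlt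
      exact (ih w' (by omega)).trans_lt (by exact_mod_cast Nat.lt_succ_self m)
  refine key n D.toModel.root ?_
  exact (hmono _ _ (D.reach_root D.toModel.root.2)).trans (derivRank_le h)

/-! ### Derivations from countermodels -/

section Completeness

variable {G : Formula} {K : KripkeModel} {a : K.World}

/-- The left formulas attached to a world `a` of a Kripke model: the forced left variables and the
forced left implications whose antecedent is not forced. -/
def core (G : Formula) (K : KripkeModel) (a : K.World) : Set Formula :=
  {X | X ∈ bar G ∧ K.Forces a X ∧ ∀ Y Z, X = .imp Y Z → ¬ K.Forces a Y}

theorem cl_core_of_forces {Z : Formula} (hZ : Z ∈ Sl G) (h : K.Forces a Z) :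
    Cl (core G K a) Z := by
  induction Z with
  | var p => exact .base ⟨Or.inl ⟨hZ, p, rfl⟩, h, by simp⟩
  | bot => exact h.elim
  | and A B ihA ihB => exact .and (ihA hZ.and_left h.1) (ihB hZ.and_right h.2)
  | or A B ihA ihB =>
    rcases h with h | h
    · exact .or_left (ihA hZ.or_left h)
    · exact .or_right (ihB hZ.or_right h)
  | imp A B ihA ihB =>
    by_cases hA : K.Forces a A
    · exact .imp (ihB hZ.imp_right ((h a le_rfl).resolve_left (not_not.2 hA)))
    · refine .base ⟨Or.inr ⟨hZ, A, B, rfl⟩, h, ?_⟩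
      rintro _ _ ⟨⟩
      exact hA

theorem forces_of_cl_core {A : Formula} (h : Cl (core G K a) A) : K.Forces a A :=
  KripkeModel.forces_of_cl h fun _ hX _ => hX.2.1

/-- The sequent `Γ ⇒ C` is derivable with rank `n` for some `Γ` whose closure contains all left
formulas forced at `a`. -/
def RegDerivable (G : Formula) (K : KripkeModel) (n : ℕ) (a : K.World) (C : Formula) : Prop :=
  ∃ Γ, DerivableIn G n (.reg Γ C) ∧ ∀ Z ∈ Sl G, K.Forces a Z → Cl Γ Z

/-- The sequent `S ; T → C` is derivable with rank `n` for some `S` and `T` bracketing the core of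
`a`. -/
def IrrDerivable (G : Formula) (K : KripkeModel) (n : ℕ) (a : K.World) (C : Formula) : Prop :=
  ∃ S T, DerivableIn G n (.irr S T C) ∧ S ⊆ core G K a ∧ core G K a ⊆ S ∪ T

theorem regDerivable_of_core {n : ℕ} {C : Formula} {Γ : Set Formula}
    (h : DerivableIn G n (.reg Γ C)) (hΓ : core G K a ⊆ Γ) : RegDerivable G K n a C :=
  ⟨Γ, h, fun _ hZ hf => (cl_core_of_forces hZ hf).mono hΓ⟩

/-- If every formula not forced at a world above `a` is refuted there by a regular sequent of rank
`n`, then every formula not forced at `a` is refuted by an irregular sequent of rank `n`: only an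
implication whose antecedent is not forced at `a` requires moving to a world above. -/
theorem irrDerivable_of_above {n : ℕ}
    (habove : ∀ b > a, ∀ C ∈ Sr G, ¬ K.Forces b C → RegDerivable G K n b C)
    {C : Formula} (hC : C ∈ Sr G) (hf : ¬ K.Forces a C) : IrrDerivable G K n a C := by
  have prime : ∀ F ∈ primes, F ∈ Sr G → ¬ K.Forces a F → IrrDerivable G K n a F := by
    intro F hF hFG hf
    refine ⟨_, _, (DerivableIn.axiom_rule (.axIrr hF hFG)).mono (Nat.zero_le n),
      Set.empty_subset _, ?_⟩
    rintro X ⟨hX | hX, hfX, -⟩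
    · exact Or.inr (Or.inl ⟨hX, fun h => hf (h ▸ hfX)⟩)
    · exact Or.inr (Or.inr hX)
  induction C with
  | var p => exact prime _ (Or.inl ⟨p, rfl⟩) hC hf
  | bot => exact prime _ (Or.inr rfl) hC hf
  | and A B ihA ihB =>
    by_cases hA : K.Forces a A
    · obtain ⟨S, T, h, hS, hT⟩ := ihB hC.and_right fun hB => hf ⟨hA, hB⟩
      exact ⟨S, T, h.unary (.andIrr₂ hC) rfl, hS, hT⟩
    · obtain ⟨S, T, h, hS, hT⟩ := ihA hC.and_left hA
      exact ⟨S, T, h.unary (.andIrr₁ hC) rfl, hS, hT⟩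
  | or A B ihA ihB =>
    obtain ⟨S₁, T₁, h₁, hS₁, hT₁⟩ := ihA hC.or_left fun h => hf (Or.inl h)
    obtain ⟨S₂, T₂, h₂, hS₂, hT₂⟩ := ihB hC.or_right fun h => hf (Or.inr h)
    refine ⟨S₁ ∪ S₂, T₁ ∩ T₂, .node (.or hC (hS₁.trans hT₂) (hS₂.trans hT₁)) (n := n) ?_ le_rfl,
      Set.union_subset hS₁ hS₂, fun X hX => ?_⟩
    · intro i
      fin_cases i
      exacts [h₁, h₂]
    · rcases hT₁ hX with h | h
      · exact Or.inl (Or.inl h)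
      · rcases hT₂ hX with h' | h'
        · exact Or.inl (Or.inr h')
        · exact Or.inr ⟨h, h'⟩
  | imp A B ihA ihB =>
    by_cases hA : K.Forces a A
    · obtain ⟨S, T, h, hS, hT⟩ := ihB hC.imp_right fun hB => hf fun b hb => Or.inr (hB.mono hb)
      -- The part of `T` moved to the left is a minimal part of the core that suffices for `A`.
      have hfin : {L | L ⊆ T ∩ core G K a ∧ Cl (S ∪ L) A}.Finite :=
        ((finite_Sl G).finite_subsets).subset fun L hL X hX =>
          bar_subset_Sl G (hL.1 hX).2.1
      have hmem : T ∩ core G K a ∈ {L | L ⊆ T ∩ core G K a ∧ Cl (S ∪ L) A} :=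
        ⟨subset_rfl, (cl_core_of_forces hC.imp_left hA).mono fun X hX =>
          (hT hX).imp id fun h => ⟨h, hX⟩⟩
      obtain ⟨L, -, ⟨hL, hLA⟩, hmin⟩ := hfin.exists_le_minimal hmem
      have hTL : T \ L ∪ L = T := Set.sdiff_union_of_subset (hL.trans Set.inter_subset_left)
      refine ⟨S ∪ L, T \ L, ?_, Set.union_subset hS (hL.trans Set.inter_subset_right), ?_⟩
      · refine DerivableIn.unary (τ := .irr S (T \ L ∪ L) B) (.impInIrr hC ?_ hLA ?_) rfl
          (hTL.symm ▸ h)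
        · exact Set.sdiff_inter_self
        · exact fun L' hL' h' => hL'.2 (hmin ⟨hL'.1.trans hL, h'⟩ hL'.1)
      · rw [Set.union_assoc, Set.union_comm L, hTL]
        exact hT
    · obtain ⟨b, hab, hbA, hbB⟩ := KripkeModel.exists_of_not_forces_imp hf
      have hlt : a < b := lt_of_le_of_ne hab fun h => hA (h ▸ hbA)
      obtain ⟨Γ, h, hΓ⟩ := habove b hlt B hC.imp_right hbB
      -- Extend the core to a maximal set whose closure misses `A`.
      have hfin : {T | T ⊆ {X | Cl Γ X} ∩ bar G ∧ ¬ Cl T A}.Finite :=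
        ((finite_Sl G).finite_subsets).subset fun T hT X hX =>
          bar_subset_Sl G (hT.1 hX).2
      have hmem : core G K a ∈ {T | T ⊆ {X | Cl Γ X} ∩ bar G ∧ ¬ Cl T A} :=
        ⟨fun X hX => ⟨hΓ X (bar_subset_Sl G hX.1) (hX.2.1.mono hab), hX.1⟩,
          fun h => hA (forces_of_cl_core h)⟩
      obtain ⟨T, hle, ⟨hT, hTA⟩, hmax⟩ := hfin.exists_le_maximal hmem
      refine ⟨∅, T, h.unary (.impNotIn hC hT (hΓ A hC.imp_left hbA) hTA ?_) rfl,
        Set.empty_subset _, hle.trans Set.subset_union_right⟩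
      intro T' hTT' hT'
      by_contra hcon
      exact hTT'.2 (hmax ⟨hT', hcon⟩ hTT'.1)

/-- Premises for a join at the world `a`: given a finite set `U` of formulas refuted at `a` and
containing the antecedents, not forced at `a`, of the left implications, there is a family of
irregular sequents whose right formulas are those of `U`, which can be joined, and such that the
core of `a` is contained in the left-hand side of the conclusion of `joinOr`. -/
theorem exists_join_premises {n : ℕ} {U : Set Formula} (hfin : U.Finite)
    (hU : ∀ C ∈ U, IrrDerivable G K n a C)
    (hU' : ∀ Y Z, .imp Y Z ∈ Sl G → ¬ K.Forces a Y → Y ∈ U) :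
    ∃ (m : ℕ) (S T : Fin m → Set Formula) (A : Fin m → Formula), Set.range A = U ∧
      (∀ j, DerivableIn G n (.irr (S j) (T j) (A j))) ∧ JoinCond S T A ∧
      (∀ j, S j ⊆ core G K a) ∧
      core G K a ⊆ sigmaAt S ∪ thetaAt T ∪ sigmaImp S ∪ thetaImp T A := by
  obtain ⟨m, A, -, rfl⟩ := hfin.fin_param
  choose S T h hS hT using fun j => hU (A j) ⟨j, rfl⟩
  refine ⟨m, S, T, A, rfl, h, ⟨fun i j _ => (hS i).trans (hT j), fun Y Z hYZ => ?_⟩, hS, ?_⟩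
  · obtain ⟨j, hj, -⟩ := Set.mem_iUnion.1 hYZ
    have := hS j hj
    exact hU' Y Z (bar_subset_Sl G this.1) (this.2.2 Y Z rfl)
  · intro X hX
    by_cases hex : ∃ j, X ∈ S j
    · obtain ⟨j, hj⟩ := hex
      rcases hX.1 with h | h
      · exact Or.inl (Or.inl (Or.inl (Set.mem_iUnion.2 ⟨j, hj, h.2⟩)))
      · exact Or.inl (Or.inr (Set.mem_iUnion.2 ⟨j, hj, h.2⟩))
    · have hall : ∀ j, X ∈ T j := fun j => (hT j hX).resolve_left fun h => hex ⟨j, h⟩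
      rcases hX.1 with h | h
      · exact Or.inl (Or.inl (Or.inr fun j => ⟨hall j, h.2⟩))
      · obtain ⟨Y, Z, rfl⟩ := h.2
        exact Or.inr ⟨fun j => ⟨hall j, h.2⟩, Y, Z, rfl, hU' Y Z h.1 (hX.2.2 Y Z rfl)⟩

/-- If every formula not forced at a world above `a` is refuted there by a regular sequent of rank
`n`, then every formula not forced at `a` is refuted by a regular sequent of rank `n + 1`, obtained
by joining the irregular sequents of `irrDerivable_of_above`. -/
theorem regDerivable_of_above {n : ℕ}
    (habove : ∀ b > a, ∀ C ∈ Sr G, ¬ K.Forces b C → RegDerivable G K n b C)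
    {C : Formula} (hC : C ∈ Sr G) (hf : ¬ K.Forces a C) : RegDerivable G K (n + 1) a C := by
  have hirr : ∀ C ∈ Sr G, ¬ K.Forces a C → IrrDerivable G K n a C :=
    fun C => irrDerivable_of_above habove
  have hfinU : {Y | (∃ Z, .imp Y Z ∈ Sl G) ∧ ¬ K.Forces a Y}.Finite :=
    (finite_Sr G).subset fun Y ⟨⟨Z, hZ⟩, _⟩ => hZ.imp_left
  have prime : ∀ F ∈ primes, F ∈ Sr G → ¬ K.Forces a F → RegDerivable G K (n + 1) a F := by
    intro F hF hFG hfF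
    have hcost : ∀ Γ, (Sequent.reg Γ F).worldCost = 1 :=
      fun Γ => Sequent.worldCost_of_mem_primes hF
    obtain ⟨m, S, T, A, hA, hder, hJ, hS, hcore⟩ := exists_join_premises hfinU
      (fun Y ⟨⟨Z, hZ⟩, hY⟩ => hirr Y hZ.imp_left hY) (fun Y Z hZ hY => ⟨⟨Z, hZ⟩, hY⟩)
    rcases Nat.eq_zero_or_pos m with rfl | hm
    · -- Without premises the core contains no implications, and an axiom suffices.
      refine regDerivable_of_core ((DerivableIn.axiom_rule (.axReg hF hFG)).mono
        (by rw [hcost]; omega)) fun X hX => ⟨?_, fun h => hfF (h ▸ hX.2.1)⟩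
      rcases hX.1 with h | ⟨h, Y, Z, rfl⟩
      · exact h
      · have : Y ∈ Set.range A := hA ▸ ⟨⟨Z, h⟩, hX.2.2 Y Z rfl⟩
        obtain ⟨j, -⟩ := this
        exact j.elim0
    · refine regDerivable_of_core (.node (.joinAt hm hFG hJ hF ?_ ?_) hder (by rw [hcost])) ?_
      · intro h
        obtain ⟨j, hj, -⟩ := Set.mem_iUnion.1 h
        exact hfF (hS j hj).2.1
      · intro Y hY
        rw [hA] at hY
        exact hY.1
      · intro X hX
        rcases hcore hX with ((h | h) | h) | h
        · exact Or.inl (Or.inl (Or.inl h))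
        · exact Or.inl (Or.inl (Or.inr ⟨h, fun h' => hfF (h' ▸ hX.2.1)⟩))
        · exact Or.inl (Or.inr h)
        · exact Or.inr h
  induction C with
  | var p => exact prime _ (Or.inl ⟨p, rfl⟩) hC hf
  | bot => exact prime _ (Or.inr rfl) hC hf
  | and A B ihA ihB =>
    by_cases hA : K.Forces a A
    · obtain ⟨Γ, h, hΓ⟩ := ihB hC.and_right fun hB => hf ⟨hA, hB⟩
      exact ⟨Γ, h.unary (.andReg₂ hC) rfl, hΓ⟩
    · obtain ⟨Γ, h, hΓ⟩ := ihA hC.and_left hA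
      exact ⟨Γ, h.unary (.andReg₁ hC) rfl, hΓ⟩
  | or A B =>
    obtain ⟨m, S, T, C, hCr, hder, hJ, hS, hcore⟩ := exists_join_premises
      (U := insert A (insert B {Y | (∃ Z, .imp Y Z ∈ Sl G) ∧ ¬ K.Forces a Y}))
      (n := n) (G := G) (a := a) ((hfinU.insert _).insert _)
      (by
        rintro Y (rfl | rfl | ⟨⟨Z, hZ⟩, hY⟩)
        · exact hirr _ hC.or_left fun h => hf (Or.inl h)
        · exact hirr _ hC.or_right fun h => hf (Or.inr h)
        · exact hirr _ hZ.imp_left hY)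
      (fun Y Z hZ hY => Or.inr (Or.inr ⟨⟨Z, hZ⟩, hY⟩))
    have hA : A ∈ Set.range C := hCr ▸ Or.inl rfl
    have hB : B ∈ Set.range C := hCr ▸ Or.inr (Or.inl rfl)
    have hm : 1 ≤ m := by
      obtain ⟨j, -⟩ := hA
      exact Nat.one_le_of_lt j.2
    refine regDerivable_of_core (.node (.joinOr hm hC hJ hA hB ?_) hder le_rfl) hcore
    intro Y hY
    rw [hCr] at hY
    rcases hY with rfl | rfl | ⟨⟨Z, hZ⟩, -⟩
    · exact ⟨B, Or.inr (Or.inl hC)⟩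
    · exact ⟨A, Or.inr (Or.inr hC)⟩
    · exact ⟨Z, Or.inl hZ⟩
  | imp A B ihA ihB =>
    obtain ⟨b, hab, hbA, hbB⟩ := KripkeModel.exists_of_not_forces_imp hf
    have hB : RegDerivable G K (n + 1) b B := by
      rcases hab.eq_or_lt with rfl | hlt
      · exact ihB hC.imp_right hbB
      · obtain ⟨Γ, h, hΓ⟩ := habove b hlt B hC.imp_right hbB
        exact ⟨Γ, h.mono n.le_succ, hΓ⟩
    obtain ⟨Γ, h, hΓ⟩ := hB
    exact ⟨Γ, h.unary (.impInReg hC (hΓ A hC.imp_left hbA)) rfl,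
      fun Z hZ hfZ => hΓ Z hZ (hfZ.mono hab)⟩

/-- A right formula not forced at a world of height at most `n` is refuted by a regular sequent of
rank `n + 1`. -/
theorem regDerivable_of_worldHeight_le (n : ℕ) (ha : K.worldHeight a ≤ n) {C : Formula}
    (hC : C ∈ Sr G) (hf : ¬ K.Forces a C) : RegDerivable G K (n + 1) a C := by
  induction n generalizing a C with
  | zero =>
    refine regDerivable_of_above (fun b hb => ?_) hC hf
    exact absurd (Order.coheight_le_coe_iff.1 ha b hb) (by simp)
  | succ n ih =>
    refine regDerivable_of_above (fun b hb C hC hf => ih ?_ hC hf) hC hf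
    have := Order.coheight_le_coe_iff.1 ha b hb
    exact Order.le_of_lt_add_one (by exact_mod_cast this)

end Completeness

theorem KripkeModel.height_lt_top (K : KripkeModel) : K.height < ⊤ := by
  have := Fintype.ofFinite K.World
  refine lt_of_le_of_lt (Order.coheight_le fun p _ => ?_) (ENat.natCast_lt_top (Fintype.card K.World))
  exact_mod_cast p.length_lt_card.le

theorem exists_isCountermodel_height_eq {G : Formula} (hG : G ∉ IPL) :
    ∃ K : KripkeModel, K.IsCountermodel G ∧ K.height = G.height := by
  obtain ⟨K₀, h₀⟩ := not_forall.1 hG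
  have : Nonempty {K : KripkeModel // K.IsCountermodel G} := ⟨⟨K₀, h₀⟩⟩
  obtain ⟨⟨K, hK⟩, h⟩ := ciInf_mem fun K : {K : KripkeModel // K.IsCountermodel G} => K.1.height
  exact ⟨K, hK, h.trans iInf_subtype⟩

end FRJ

theorem mainTheorem3 (G : FRJ.Formula) (hG : G ∉ FRJ.IPL) :
    ∃ (Γ : Set FRJ.Formula) (D : FRJ.Derivation G (FRJ.Sequent.reg Γ G)),
      D.toModel.IsCountermodel G ∧ D.toModel.height = G.height := by
  obtain ⟨K, hK, hmin⟩ := FRJ.exists_isCountermodel_height_eq hG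
  obtain ⟨n, hn⟩ := ENat.ne_top_iff_exists.1 K.height_lt_top.ne
  obtain ⟨Γ, h, -⟩ := FRJ.regDerivable_of_worldHeight_le n hn.ge FRJ.SignedSub.self hK
  obtain ⟨D, hD⟩ := h.exists_toModel_height_le
  refine ⟨Γ, D, D.toModel_isCountermodel, le_antisymm ?_
    (iInf₂_le (f := fun K _ => FRJ.KripkeModel.height K) _ D.toModel_isCountermodel)⟩
  rw [← hmin, ← hn]
  exact hD
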